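/- Let $n\ge 3$, and let $u\ne v$ be two of the nodes $1,\dots,n$. For a simple undirected graph $G$ on these nodes, with Laplacian $L=D-A$, let $L=U\Lambda U^\top$ be an eigendecomposition with $U$ orthogonal and $\Lambda=\operatorname{diag}(\lambda_1\le\dots\le\lambda_n)$. The full Laplacian tokenization is the matrix $X=\mathcal P_{\mathrm{Lap}}(G)\in\mathbb R^{n\times 2n}$ whose row for the node $w$ is $(U_{w1},\dots,U_{wn},\lambda_1,\dots,\lambda_n)$. Let $T$ be a one-layer transformer without residual connections, with $H$ heads of dimension $d_h$ and hidden dimension $m=Hd_h$. It has an input projection $W_{\mathrm{in}}\in\mathbb R^{2n\times m}$ with $\|W_{\mathrm{in}}\|_2\le 1$ (for instance the identity when $m=2n$), query-key matrices $W_{QK}^{1},\dots,W_{QK}^{H}\in\mathbb R^{m\times m}$, a value matrix $W_V=[W_V^1,\dots,W_V^H]\in\mathbb R^{m\times m}$ with blocks $W_V^h\in\mathbb R^{m\times d_h}$, and a decoder $\mathrm{MLP}:\mathbb R^{m}\times\mathbb R^m\to\mathbb R$ with Lipschitz constant $\mathrm{Lip}_{\mathrm{MLP}}$ for the Euclidean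 norm. With $Y=XW_{\mathrm{in}}$ and $P^h=\mathrm{softmax}(YW_{QK}^hY^\top)$ (row-wise), the representation $h_w$ of a node $w$ is the concatenation over $h$ of the vectors $\sum_{w'}P^h_{ww'}Y_{w'}W_V^h$, and the output of $T$ is $\hat A_{uv}=\mathrm{MLP}(h_u,h_v)$. Suppose that $T$ predicts the edge $(u,v)$ in graphs of maximum degree $d_{\max}$: for every graph on the $n$ nodes with maximum degree $d_{\max}$ and for every choice of the eigendecomposition above, $\hat A_{uv}=A_{uv}$. Then, for every such graph and its tokens $X$, \[ \mathrm{Lip}_{\mathrm{MLP}}\cdot\|W_V\|_2\,(1+\gamma)\ \ge\ d_{\max},\qquad \gamma=\|W_{QK}\|_2\,\|X\|_2^2, \] where $\|\cdot\|_2$ is the spectral norm and $\|W_{QK}\|_2=\max_h\|W_{QK}^h\|_2$. -/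

import Mathlib

open scoped NNReal Matrix.Norms.L2Operator

noncomputable section

/-- `U` and `lam` form an orthonormal eigendecomposition `U diag(lam) Uᵀ` of the Laplacian
`L = D - A` of `G`, the eigenvalues being listed in nondecreasing order. If an eigenvalue is
repeated (and up to signs in any case) several `U` qualify. -/
structure IsLaplacianDecomposition {n : ℕ} (G : SimpleGraph (Fin n)) [DecidableRel G.Adj]
    (U : Matrix (Fin n) (Fin n) ℝ) (lam : Fin n → ℝ) : Prop where
  orthogonal : U ∈ Matrix.orthogonalGroup (Fin n) ℝ
  sorted : Monotone lam
  decomposition : G.lapMatrix ℝ = U * Matrix.diagonal lam * U.transpose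

/-- The full Laplacian (spectral) token matrix in `ℝ^(n × 2n)`: the row of the node `v` is
`(u_1(v), …, u_n(v), lam_1, …, lam_n)`, where `u_k` is the `k`-th column of `U`. -/
def laplacianTokens {n : ℕ} (U : Matrix (Fin n) (Fin n) ℝ) (lam : Fin n → ℝ) :
    Matrix (Fin n) (Fin n ⊕ Fin n) ℝ :=
  Matrix.fromCols U (Matrix.of fun _ k => lam k)

/-- Row-wise softmax. -/
def rowSoftmax {n : ℕ} (S : Matrix (Fin n) (Fin n) ℝ) : Matrix (Fin n) (Fin n) ℝ :=
  Matrix.of fun u w => Real.exp (S u w) / ∑ w', Real.exp (S u w')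

/-- Parameters of a one-layer softmax transformer (no residual connection) on `n` tokens in
`ℝ^(2n)`, with `H` heads of dimension `dh`, hence hidden dimension `m = H * dh`:
* `Win` is the input projection;
* `WQK h` is the query-key matrix of the head `h`, the product of the query and the transposed key
  matrix, with the factor `1 / √dh` included;
* `WV` is the value matrix, the concatenation of the `m × dh` value matrices of the heads;
* `mlp` is the decoder, applied to the concatenation of two token representations. It may be any
  function; `WithLp 2` puts the Euclidean norm of `ℝ^(2m)` on its domain. -/
structure OneLayerTransformer (n H dh : ℕ) where
  Win : Matrix (Fin n ⊕ Fin n) (Fin (H * dh)) ℝ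
  WQK : Fin H → Matrix (Fin (H * dh)) (Fin (H * dh)) ℝ
  WV : Matrix (Fin (H * dh)) (Fin (H * dh)) ℝ
  mlp : WithLp 2 (EuclideanSpace ℝ (Fin (H * dh)) × EuclideanSpace ℝ (Fin (H * dh))) → ℝ

namespace OneLayerTransformer

variable {n H dh : ℕ} (T : OneLayerTransformer n H dh)

/-- Attention matrix of the head `h`: `softmax (Y WQK Yᵀ)` with `Y = X Win`. -/
def attention (X : Matrix (Fin n) (Fin n ⊕ Fin n) ℝ) (h : Fin H) : Matrix (Fin n) (Fin n) ℝ :=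
  rowSoftmax ((X * T.Win) * T.WQK h * (X * T.Win).transpose)

/-- Representation of the node `u` after the attention layer, the concatenation of the outputs
`∑ w, P_{uw} Y_w WV` of the heads. The coordinate `j` belongs to the head `j.divNat = j / dh`. -/
def hidden (X : Matrix (Fin n) (Fin n ⊕ Fin n) ℝ) (u : Fin n) :
    EuclideanSpace ℝ (Fin (H * dh)) :=
  WithLp.toLp 2 fun j => (T.attention X j.divNat * (X * T.Win * T.WV)) u j

/-- The output `MLP(h_u, h_v)` for the pair `(u, v)`. -/
def edgeOutput (X : Matrix (Fin n) (Fin n ⊕ Fin n) ℝ) (u v : Fin n) : ℝ :=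
  T.mlp (WithLp.toLp 2 (T.hidden X u, T.hidden X v))

/-- `T` predicts the edge `(u, v)` in the graphs on `n` nodes with maximum degree `d`: from the
Laplacian tokens of any such graph, whichever orthonormal eigenbasis they are computed from, it
outputs the adjacency entry `A_{uv}`. -/
def PredictsEdge (u v : Fin n) (d : ℕ) : Prop :=
  ∀ (G : SimpleGraph (Fin n)) [DecidableRel G.Adj], G.maxDegree = d →
    ∀ (U : Matrix (Fin n) (Fin n) ℝ) (lam : Fin n → ℝ), IsLaplacianDecomposition G U lam →
      T.edgeOutput (laplacianTokens U lam) u v = G.adjMatrix ℝ u v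

/-- Maximum logit energy `γ = ‖W_QK‖₂ ‖X‖₂²` (spectral norms), where `‖W_QK‖₂` is the largest norm
among the heads. -/
def logitEnergy (X : Matrix (Fin n) (Fin n ⊕ Fin n) ℝ) : ℝ :=
  (⨆ h, ‖T.WQK h‖) * ‖X‖ ^ 2

end OneLayerTransformer

end

open scoped NNReal Matrix.Norms.L2Operator

/-! Relabelling the nodes permutes the rows of `U` and keeps the spectrum. A graph with both an edge
and a non-edge thus has two relabellings whose tokens are the same rows in different orders, while
the correct outputs at `(u, v)` are 1 and 0. Attention sees this difference only by deviating from
uniform weights, whose average ignores the order. Tokens are orthonormal rows plus a common row. The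
common row shifts all logits of a query equally and cancels in the deviation. Softmax being
1/2-Lipschitz, `sum_sq_hidden_sub_mean_le` bounds that deviation, and the decoder gives `1 ≤
2n(1+M)(Lip ‖WV‖ κ)²`, with `M = ∑ λ²` and `κ` the query-key norm (`sq_sub_edgeOutput_le`).
Conversely `‖X‖² ≥ 1 + nM` and `M ≥ dmax²`, so the logit energy is large enough. A complete graph
has no non-edge; deleting one edge repairs this without lowering the maximum degree or raising `M`.
-/

/-! ### Softmax near uniform weights -/

theorem exp_sub_one_le_mul_exp_add_one {x : ℝ} (hx : 0 ≤ x) :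
    Real.exp x - 1 ≤ x * ((Real.exp x + 1) / 2) := by
  have hd : ∀ y : ℝ, HasDerivAt (fun y : ℝ => y * ((Real.exp y + 1) / 2) - (Real.exp y - 1))
      (1 * ((Real.exp y + 1) / 2) + y * (Real.exp y / 2) - Real.exp y) y := fun y =>
    ((hasDerivAt_id y).mul (((Real.hasDerivAt_exp y).add_const 1).div_const 2)).sub
      ((Real.hasDerivAt_exp y).sub_const 1)
  have hmono : Monotone (fun y : ℝ => y * ((Real.exp y + 1) / 2) - (Real.exp y - 1)) := by
    refine monotone_of_hasDerivAt_nonneg hd fun y => ?_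
    -- The derivative is `(1 + y e^y - e^y) / 2`, nonnegative because `1 - y ≤ e^(-y)`.
    have h1 := Real.add_one_le_exp (-y)
    have h2 : Real.exp y * Real.exp (-y) = 1 := by rw [← Real.exp_add]; simp
    have h3 := mul_le_mul_of_nonneg_left h1 (Real.exp_pos y).le
    simp only [Pi.zero_apply]
    linarith
  have := hmono hx
  simp only [zero_mul, Real.exp_zero, sub_self] at this
  linarith

/-- The logarithmic mean of two positive numbers is at most their arithmetic mean. -/
theorem sq_exp_sub_exp_le (a b : ℝ) :
    (Real.exp a - Real.exp b) ^ 2 ≤ (a - b) ^ 2 * ((Real.exp a + Real.exp b) / 2) ^ 2 := by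
  wlog hab : b ≤ a generalizing a b
  · have := this b a (le_of_not_ge hab)
    nlinarith
  have h := exp_sub_one_le_mul_exp_add_one (sub_nonneg.2 hab)
  have he : Real.exp a = Real.exp b * Real.exp (a - b) := by rw [← Real.exp_add]; simp
  have hle := Real.exp_le_exp.2 hab
  rw [← mul_pow]
  refine pow_le_pow_left₀ (sub_nonneg.2 hle) ?_ 2
  have := mul_le_mul_of_nonneg_left h (Real.exp_pos b).le
  rw [he]
  linarith

theorem sum_sum_sq_sub {ι : Type*} [Fintype ι] (a : ι → ℝ) :
    ∑ i, ∑ j, (a i - a j) ^ 2 =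
      2 * Fintype.card ι * ∑ i, a i ^ 2 - 2 * (∑ i, a i) ^ 2 := by
  simp only [sub_sq, Finset.sum_add_distrib, Finset.sum_sub_distrib, Finset.sum_const,
    Finset.card_univ, nsmul_eq_mul, ← Finset.mul_sum, ← Finset.sum_mul]
  ring

theorem rowSoftmax_nonneg {n : ℕ} (S : Matrix (Fin n) (Fin n) ℝ) (u w : Fin n) :
    0 ≤ rowSoftmax S u w := by
  simp only [rowSoftmax, Matrix.of_apply]
  positivity

theorem sum_rowSoftmax {n : ℕ} (S : Matrix (Fin n) (Fin n) ℝ) (u : Fin n) :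
    ∑ w, rowSoftmax S u w = 1 := by
  simp only [rowSoftmax, Matrix.of_apply, ← Finset.sum_div]
  exact div_self (Finset.sum_pos (fun w _ => Real.exp_pos (S u w)) ⟨u, Finset.mem_univ u⟩).ne'

theorem sq_rowSoftmax_sub_le {n : ℕ} (S : Matrix (Fin n) (Fin n) ℝ) (u i j : Fin n) :
    (rowSoftmax S u i - rowSoftmax S u j) ^ 2 ≤ (S u i - S u j) ^ 2 / 4 := by
  rcases eq_or_ne i j with rfl | hij
  · simp
  have hsum : rowSoftmax S u i + rowSoftmax S u j ≤ 1 := by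
    rw [← sum_rowSoftmax S u, ← Finset.sum_pair hij]
    exact Finset.sum_le_sum_of_subset_of_nonneg (Finset.subset_univ _)
      fun w _ _ => rowSoftmax_nonneg S u w
  have h0 : 0 ≤ rowSoftmax S u i + rowSoftmax S u j :=
    add_nonneg (rowSoftmax_nonneg S u i) (rowSoftmax_nonneg S u j)
  have hmain : (rowSoftmax S u i - rowSoftmax S u j) ^ 2 ≤
      (S u i - S u j) ^ 2 * ((rowSoftmax S u i + rowSoftmax S u j) / 2) ^ 2 := by
    have h := div_le_div_of_nonneg_right (sq_exp_sub_exp_le (S u i) (S u j))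
      (sq_nonneg (∑ w, Real.exp (S u w)))
    simp only [rowSoftmax, Matrix.of_apply]
    rw [← sub_div, ← add_div, div_pow, div_right_comm, div_pow (_ / 2), ← mul_div_assoc]
    exact h
  nlinarith [sq_nonneg (S u i - S u j), pow_le_one₀ h0 hsum (n := 2)]

/-- Softmax is `1/2`-Lipschitz around the constant logits, for the Euclidean norm. -/
theorem sum_sq_rowSoftmax_sub_inv_card_le {n : ℕ} (S : Matrix (Fin n) (Fin n) ℝ) (u : Fin n)
    (c : ℝ) :
    ∑ w, (rowSoftmax S u w - 1 / n) ^ 2 ≤ (∑ w, (S u w - c) ^ 2) / 4 := by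
  have hn : (0 : ℝ) < n := Nat.cast_pos.2 u.pos
  have hle : ∑ i, ∑ j, (rowSoftmax S u i - 1 / n - (rowSoftmax S u j - 1 / n)) ^ 2 ≤
      (∑ i, ∑ j, (S u i - c - (S u j - c)) ^ 2) / 4 := by
    simp only [sub_sub_sub_cancel_right, Finset.sum_div]
    exact Finset.sum_le_sum fun i _ => Finset.sum_le_sum fun j _ => sq_rowSoftmax_sub_le S u i j
  -- Pairwise differences become variances; the softmax deviations have sum zero, and the squared
  -- sum on the logit side can be dropped.
  rw [sum_sum_sq_sub, sum_sum_sq_sub] at hle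
  have h0 : ∑ w, (rowSoftmax S u w - 1 / n) = 0 := by
    rw [Finset.sum_sub_distrib, sum_rowSoftmax]
    simp [hn.ne']
  rw [h0, Fintype.card_fin] at hle
  have h1 := sq_nonneg (∑ w, (S u w - c))
  refine le_of_mul_le_mul_left ?_ hn
  linarith

/-! ### Spectral norm estimates -/

section SpectralNorm

variable {m n : Type*} [Fintype m] [Fintype n] [DecidableEq n]

theorem sum_sq_mulVec_le (A : Matrix m n ℝ) (x : n → ℝ) :
    ∑ i, (A.mulVec x) i ^ 2 ≤ ‖A‖ ^ 2 * ∑ j, x j ^ 2 := by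
  have h := pow_le_pow_left₀ (norm_nonneg _) (Matrix.l2_opNorm_mulVec A (WithLp.toLp 2 x)) 2
  rw [mul_pow, EuclideanSpace.real_norm_sq_eq, EuclideanSpace.real_norm_sq_eq] at h
  exact h

variable [DecidableEq m]

theorem l2_opNorm_transpose (A : Matrix m n ℝ) : ‖A.transpose‖ = ‖A‖ := by
  rw [← Matrix.conjTranspose_eq_transpose_of_trivial, Matrix.l2_opNorm_conjTranspose]

theorem sum_sq_vecMul_le (A : Matrix m n ℝ) (x : m → ℝ) :
    ∑ j, (Matrix.vecMul x A) j ^ 2 ≤ ‖A‖ ^ 2 * ∑ i, x i ^ 2 := by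
  rw [← l2_opNorm_transpose A, ← Matrix.mulVec_transpose]
  exact sum_sq_mulVec_le A.transpose x

theorem sum_sq_row_le (A : Matrix m n ℝ) (i : m) : ∑ j, A i j ^ 2 ≤ ‖A‖ ^ 2 := by
  have h := sum_sq_vecMul_le A (Pi.single i 1)
  simpa [Pi.single_apply] using h

theorem sum_sum_sq_le (A : Matrix m n ℝ) : ∑ i, ∑ j, A i j ^ 2 ≤ Fintype.card m * ‖A‖ ^ 2 := by
  refine (Finset.sum_le_sum fun i _ => sum_sq_row_le A i).trans ?_
  simp

theorem l2_opNorm_sq_eq_mul_transpose (A : Matrix m n ℝ) : ‖A * A.transpose‖ = ‖A‖ ^ 2 := by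
  have h := Matrix.l2_opNorm_conjTranspose_mul_self A.transpose
  rw [Matrix.conjTranspose_eq_transpose_of_trivial, Matrix.transpose_transpose,
    l2_opNorm_transpose] at h
  rw [h, sq]

theorem l2_opNorm_le_one_of_mul_transpose_eq_one {A : Matrix m n ℝ} (h : A * A.transpose = 1) :
    ‖A‖ ≤ 1 := by
  have h1 : ‖A‖ ^ 2 ≤ 1 := by
    rw [← l2_opNorm_sq_eq_mul_transpose, h]
    rcases isEmpty_or_nonempty m
    · rw [Subsingleton.elim (1 : Matrix m m ℝ) 0]; simp
    · exact norm_one.le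
  exact (sq_le_one_iff₀ (norm_nonneg _)).1 h1

end SpectralNorm

/-! ### Geometry of the tokens -/

section Tokens

variable {n : ℕ} {U : Matrix (Fin n) (Fin n) ℝ}

theorem submatrix_perm_mul_transpose (hU : U * U.transpose = 1) (σ : Equiv.Perm (Fin n)) :
    U.submatrix σ id * (U.submatrix σ id).transpose = 1 := by
  rw [Matrix.transpose_submatrix, ← Matrix.submatrix_mul _ _ _ _ _ Function.bijective_id, hU,
    Matrix.submatrix_one_equiv]

theorem laplacianTokens_mul_transpose_apply (hU : U * U.transpose = 1) (lam : Fin n → ℝ)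
    (i j : Fin n) :
    (laplacianTokens U lam * (laplacianTokens U lam).transpose) i j =
      (1 : Matrix (Fin n) (Fin n) ℝ) i j + ∑ k, lam k ^ 2 := by
  rw [← hU]
  simp [laplacianTokens, Matrix.mul_apply, sq]

theorem sum_sq_laplacianTokens_row (hU : U * U.transpose = 1) (lam : Fin n → ℝ) (i : Fin n) :
    ∑ k, laplacianTokens U lam i k ^ 2 = 1 + ∑ k, lam k ^ 2 := by
  have h := laplacianTokens_mul_transpose_apply hU lam i i
  rw [Matrix.one_apply_eq] at h
  rw [← h]
  simp only [Matrix.mul_apply, Matrix.transpose_apply, sq]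

/-- The all-ones vector is an eigenvector of `X Xᵀ = I + M 11ᵀ` with eigenvalue `1 + nM`. -/
theorem one_add_le_sq_norm_laplacianTokens (hn : 0 < n) (hU : U * U.transpose = 1)
    (lam : Fin n → ℝ) :
    1 + n * ∑ k, lam k ^ 2 ≤ ‖laplacianTokens U lam‖ ^ 2 := by
  have hn' : (0 : ℝ) < n := Nat.cast_pos.2 hn
  have hM : 0 ≤ ∑ k, lam k ^ 2 := Finset.sum_nonneg fun k _ => sq_nonneg _
  rw [← l2_opNorm_sq_eq_mul_transpose]
  have h := sum_sq_mulVec_le (laplacianTokens U lam * (laplacianTokens U lam).transpose)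
    (fun _ => 1)
  have hrow : ∀ i, (Matrix.mulVec (laplacianTokens U lam * (laplacianTokens U lam).transpose)
      (fun _ => 1)) i = 1 + n * ∑ k, lam k ^ 2 := by
    intro i
    simp only [Matrix.mulVec, dotProduct, laplacianTokens_mul_transpose_apply hU, mul_one,
      Finset.sum_add_distrib]
    simp [Matrix.one_apply]
  simp only [hrow, Finset.sum_const, Finset.card_univ, Fintype.card_fin, nsmul_eq_mul, one_pow,
    mul_one] at h
  rw [mul_comm] at h
  exact le_of_sq_le_sq (le_of_mul_le_mul_right h hn') (norm_nonneg _)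

theorem fromCols_zero_mul_transpose (hU : U * U.transpose = 1) :
    Matrix.fromCols U (0 : Matrix (Fin n) (Fin n) ℝ) *
      (Matrix.fromCols U (0 : Matrix (Fin n) (Fin n) ℝ)).transpose = 1 := by
  rw [Matrix.transpose_fromCols, Matrix.fromCols_mul_fromRows, hU]
  simp

theorem laplacianTokens_eq_add (lam : Fin n → ℝ) :
    laplacianTokens U lam =
      Matrix.fromCols U 0 + Matrix.of fun _ k => Sum.elim (fun _ => 0) lam k := by
  ext i (k | k) <;> simp [laplacianTokens]

end Tokens

/-! ### Sensitivity of attention to row order -/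

namespace OneLayerTransformer

variable {n H dh : ℕ} (T : OneLayerTransformer n H dh)

/-- The Euclidean distance from a node representation to the value averaged uniformly over all
tokens `Z + 1 cᵀ`, where `Z` has orthonormal rows, is controlled by the query-key matrices. -/
theorem sum_sq_hidden_sub_mean_le (hWin : ‖T.Win‖ ≤ 1) {κ : ℝ} (hκ : ∀ h, ‖T.WQK h‖ ≤ κ)
    {X Z : Matrix (Fin n) (Fin n ⊕ Fin n) ℝ} {c : Fin n ⊕ Fin n → ℝ}
    (hX : X = Z + Matrix.of fun _ k => c k) (hZ : Z * Z.transpose = 1) (u : Fin n) :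
    ∑ j, (T.hidden X u j - 1 / n * ∑ w, (X * T.Win * T.WV) w j) ^ 2 ≤
      κ ^ 2 * (∑ k, X u k ^ 2) / 4 * (n * ‖T.WV‖ ^ 2) := by
  have hn : (0 : ℝ) < n := Nat.cast_pos.2 u.pos
  have hZn := l2_opNorm_le_one_of_mul_transpose_eq_one hZ
  have hZW : ‖Z * T.Win‖ ≤ 1 :=
    (Matrix.l2_opNorm_mul _ _).trans (mul_le_one₀ hZn (norm_nonneg _) hWin)
  have hZWV : ‖Z * T.Win * T.WV‖ ≤ ‖T.WV‖ :=
    (Matrix.l2_opNorm_mul _ _).trans (mul_le_of_le_one_left (norm_nonneg _) hZW)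
  have hXu : ∀ {p : Type} [Fintype p] (W : Matrix (Fin n ⊕ Fin n) p ℝ) (w : Fin n) (j : p),
      (X * W) w j = (Z * W) w j + Matrix.vecMul c W j := by
    intro p _ W w j
    rw [hX, Matrix.add_mul]
    rfl
  have hatt : ∀ h, ∑ w, (T.attention X h u w - 1 / n) ^ 2 ≤ κ ^ 2 * (∑ k, X u k ^ 2) / 4 := by
    intro h
    set r : Fin (H * dh) → ℝ := Matrix.vecMul ((X * T.Win) u) (T.WQK h) with hr
    -- The common row `c` adds the same constant to every logit of the query `u`, leaving only `Z`
    -- on the key side.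
    have hS : ∀ w, ((X * T.Win) * T.WQK h * (X * T.Win).transpose) u w -
        r ⬝ᵥ Matrix.vecMul c T.Win = ((Z * T.Win).mulVec r) w := by
      intro w
      have h1 : ((X * T.Win) * T.WQK h * (X * T.Win).transpose) u w =
          r ⬝ᵥ (X * T.Win) w := rfl
      have h2 : (X * T.Win) w = (Z * T.Win) w + Matrix.vecMul c T.Win := by
        ext j
        exact hXu _ _ _
      rw [h1, h2, dotProduct_add, add_sub_cancel_right, dotProduct_comm]
      rfl
    refine (sum_sq_rowSoftmax_sub_inv_card_le _ u (r ⬝ᵥ Matrix.vecMul c T.Win)).trans ?_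
    simp only [hS]
    have hκ0 := (norm_nonneg _).trans (hκ h)
    have e1 := sum_sq_mulVec_le (Z * T.Win) r
    have e2 := sum_sq_vecMul_le (T.WQK h) ((X * T.Win) u)
    have e3 := sum_sq_vecMul_le T.Win (X u)
    have f1 : ‖Z * T.Win‖ ^ 2 ≤ 1 := pow_le_one₀ (norm_nonneg _) hZW
    have f2 : ‖T.WQK h‖ ^ 2 ≤ κ ^ 2 := pow_le_pow_left₀ (norm_nonneg _) (hκ h) 2
    have f3 : ‖T.Win‖ ^ 2 ≤ 1 := pow_le_one₀ (norm_nonneg _) hWin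
    have g3 : ∑ j, ((X * T.Win) u j) ^ 2 ≤ ∑ k, X u k ^ 2 :=
      e3.trans (mul_le_of_le_one_left (Finset.sum_nonneg fun _ _ => sq_nonneg _) f3)
    have g2 : ∑ j, r j ^ 2 ≤ κ ^ 2 * ∑ k, X u k ^ 2 :=
      e2.trans (mul_le_mul f2 g3 (Finset.sum_nonneg fun _ _ => sq_nonneg _) (sq_nonneg _))
    have g1 := e1.trans (mul_le_of_le_one_left (Finset.sum_nonneg fun _ _ => sq_nonneg _) f1)
    linarith
  have hcoord : ∀ j, T.hidden X u j - 1 / n * ∑ w, (X * T.Win * T.WV) w j =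
      ∑ w, (T.attention X j.divNat u w - 1 / n) * (Z * T.Win * T.WV) w j := by
    intro j
    have h1 : T.hidden X u j =
        ∑ w, T.attention X j.divNat u w * (X * T.Win * T.WV) w j := rfl
    have h2 : ∑ w, (T.attention X j.divNat u w - 1 / n) = 0 := by
      rw [Finset.sum_sub_distrib, attention, sum_rowSoftmax]
      simp [hn.ne']
    rw [h1, Finset.mul_sum, ← Finset.sum_sub_distrib]
    -- The deviations from `1/n` sum to zero, so the contribution of `c` to the values cancels.
    have h3 := congrArg (· * Matrix.vecMul c (T.Win * T.WV) j) h2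
    simp only [zero_mul, Finset.sum_mul] at h3
    rw [← add_zero (∑ w, _ * (Z * T.Win * T.WV) w j), ← h3, ← Finset.sum_add_distrib]
    refine Finset.sum_congr rfl fun w _ => ?_
    rw [Matrix.mul_assoc, Matrix.mul_assoc, hXu]
    ring
  have hB := sum_sum_sq_le (Z * T.Win * T.WV)
  rw [Finset.sum_comm, Fintype.card_fin] at hB
  have hK : 0 ≤ κ ^ 2 * (∑ k, X u k ^ 2) / 4 := by positivity
  calc ∑ j, (T.hidden X u j - 1 / n * ∑ w, (X * T.Win * T.WV) w j) ^ 2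
      ≤ ∑ j, κ ^ 2 * (∑ k, X u k ^ 2) / 4 * ∑ w, (Z * T.Win * T.WV) w j ^ 2 := by
        refine Finset.sum_le_sum fun j _ => ?_
        rw [hcoord]
        exact (Finset.sum_mul_sq_le_sq_mul_sq _ _ _).trans
          (mul_le_mul_of_nonneg_right (hatt _) (Finset.sum_nonneg fun _ _ => sq_nonneg _))
    _ = κ ^ 2 * (∑ k, X u k ^ 2) / 4 * ∑ j, ∑ w, (Z * T.Win * T.WV) w j ^ 2 :=
        (Finset.mul_sum _ _ _).symm
    _ ≤ κ ^ 2 * (∑ k, X u k ^ 2) / 4 * (n * ‖T.WV‖ ^ 2) := by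
        refine mul_le_mul_of_nonneg_left (hB.trans ?_) hK
        gcongr

/-- Two token matrices which agree up to a permutation of the rows have close representations. -/
theorem sq_norm_hidden_sub_hidden_le (hWin : ‖T.Win‖ ≤ 1) {κ : ℝ} (hκ : ∀ h, ‖T.WQK h‖ ≤ κ)
    {U : Matrix (Fin n) (Fin n) ℝ} (hU : U * U.transpose = 1) (lam : Fin n → ℝ)
    (σ τ : Equiv.Perm (Fin n)) (u : Fin n) :
    ‖T.hidden (laplacianTokens (U.submatrix σ id) lam) u -
        T.hidden (laplacianTokens (U.submatrix τ id) lam) u‖ ^ 2 ≤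
      κ ^ 2 * (1 + ∑ k, lam k ^ 2) * (n * ‖T.WV‖ ^ 2) := by
  have htok : ∀ ρ : Equiv.Perm (Fin n), laplacianTokens (U.submatrix ρ id) lam =
      (laplacianTokens U lam).submatrix ρ id := by
    intro ρ
    ext i (k | k) <;> simp [laplacianTokens]
  -- The uniform average is blind to row order, so both representations lie near the same centre.
  have hmean : ∀ (ρ : Equiv.Perm (Fin n)) j,
      ∑ w, (laplacianTokens (U.submatrix ρ id) lam * T.Win * T.WV) w j =
        ∑ w, (laplacianTokens U lam * T.Win * T.WV) w j := by
    intro ρ j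
    rw [← Equiv.sum_comp ρ fun w => (laplacianTokens U lam * T.Win * T.WV) w j, htok]
    rfl
  have hdev : ∀ ρ : Equiv.Perm (Fin n), ∑ j, (T.hidden (laplacianTokens (U.submatrix ρ id) lam) u j
      - 1 / n * ∑ w, (laplacianTokens U lam * T.Win * T.WV) w j) ^ 2 ≤
        κ ^ 2 * (1 + ∑ k, lam k ^ 2) / 4 * (n * ‖T.WV‖ ^ 2) := by
    intro ρ
    have h := T.sum_sq_hidden_sub_mean_le hWin hκ (laplacianTokens_eq_add lam)
      (fromCols_zero_mul_transpose (submatrix_perm_mul_transpose hU ρ)) u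
    simpa only [hmean, sum_sq_laplacianTokens_row (submatrix_perm_mul_transpose hU ρ)] using h
  rw [EuclideanSpace.real_norm_sq_eq]
  -- From `(x - y)² ≤ 2(x - a)² + 2(y - a)²`; the resulting factor 4 absorbs the `1/4` from softmax.
  calc _ ≤ ∑ j, (2 * (T.hidden (laplacianTokens (U.submatrix σ id) lam) u j
      - 1 / n * ∑ w, (laplacianTokens U lam * T.Win * T.WV) w j) ^ 2 +
      2 * (T.hidden (laplacianTokens (U.submatrix τ id) lam) u j
      - 1 / n * ∑ w, (laplacianTokens U lam * T.Win * T.WV) w j) ^ 2) := by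
        refine Finset.sum_le_sum fun j _ => ?_
        rw [PiLp.sub_apply]
        generalize 1 / (n : ℝ) * ∑ w, (laplacianTokens U lam * T.Win * T.WV) w j = a
        generalize T.hidden (laplacianTokens (U.submatrix σ id) lam) u j = x
        generalize T.hidden (laplacianTokens (U.submatrix τ id) lam) u j = y
        nlinarith [sq_nonneg (x + y - 2 * a)]
    _ ≤ _ := by
        rw [Finset.sum_add_distrib, ← Finset.mul_sum, ← Finset.mul_sum]
        linarith [hdev σ, hdev τ]

theorem norm_WQK_le_iSup (h : Fin H) : ‖T.WQK h‖ ≤ ⨆ h, ‖T.WQK h‖ :=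
  le_ciSup (f := fun h => ‖T.WQK h‖) (Set.finite_range _).bddAbove h

theorem sq_sub_edgeOutput_le (hWin : ‖T.Win‖ ≤ 1) {LipMLP : ℝ≥0}
    (hLip : LipschitzWith LipMLP T.mlp)
    {U : Matrix (Fin n) (Fin n) ℝ} (hU : U * U.transpose = 1) (lam : Fin n → ℝ)
    (σ τ : Equiv.Perm (Fin n)) (u v : Fin n) :
    (T.edgeOutput (laplacianTokens (U.submatrix σ id) lam) u v -
        T.edgeOutput (laplacianTokens (U.submatrix τ id) lam) u v) ^ 2 ≤
      2 * n * (1 + ∑ k, lam k ^ 2) * ((LipMLP : ℝ) * ‖T.WV‖ * ⨆ h, ‖T.WQK h‖) ^ 2 := by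
  have hu := T.sq_norm_hidden_sub_hidden_le hWin T.norm_WQK_le_iSup hU lam σ τ u
  have hv := T.sq_norm_hidden_sub_hidden_le hWin T.norm_WQK_le_iSup hU lam σ τ v
  have h := hLip.dist_le_mul
    (WithLp.toLp 2 (T.hidden (laplacianTokens (U.submatrix σ id) lam) u,
      T.hidden (laplacianTokens (U.submatrix σ id) lam) v))
    (WithLp.toLp 2 (T.hidden (laplacianTokens (U.submatrix τ id) lam) u,
      T.hidden (laplacianTokens (U.submatrix τ id) lam) v))
  rw [Real.dist_eq, dist_eq_norm] at h
  have h2 := pow_le_pow_left₀ (abs_nonneg _) h 2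
  rw [sq_abs, mul_pow, WithLp.prod_norm_sq_eq_of_L2] at h2
  refine h2.trans ((mul_le_mul_of_nonneg_left (add_le_add hu hv) (sq_nonneg _)).trans_eq ?_)
  ring

end OneLayerTransformer

/-! ### Relabellings and Laplacian spectra -/

theorem Equiv.Perm.exists_apply_eq_and_apply_eq {α : Type*} [DecidableEq α] {a b u v : α} (hab : a ≠ b)
    (huv : u ≠ v) : ∃ σ : Equiv.Perm α, σ u = a ∧ σ v = b := by
  refine ⟨(Equiv.swap u a).trans (Equiv.swap (Equiv.swap u a v) b), ?_, ?_⟩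
  · have h1 : Equiv.swap u a v ≠ a := by
      intro h
      apply huv
      rw [← (Equiv.swap u a).injective.eq_iff, h, Equiv.swap_apply_left]
    simp [Equiv.swap_apply_of_ne_of_ne h1.symm hab]
  · simp

namespace IsLaplacianDecomposition

variable {n : ℕ} {G : SimpleGraph (Fin n)} [DecidableRel G.Adj]
  {U : Matrix (Fin n) (Fin n) ℝ} {lam : Fin n → ℝ}

theorem mul_transpose (h : IsLaplacianDecomposition G U lam) : U * U.transpose = 1 :=
  (Matrix.mem_orthogonalGroup_iff _ _).1 h.orthogonal

theorem transpose_mul (h : IsLaplacianDecomposition G U lam) : U.transpose * U = 1 :=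
  (Matrix.mem_orthogonalGroup_iff' _ _).1 h.orthogonal

/-- The Frobenius norm is orthogonally invariant; this makes `M` computable from the entries of the
Laplacian. -/
theorem sum_sq_eigenvalues (h : IsLaplacianDecomposition G U lam) :
    ∑ k, lam k ^ 2 = ∑ i, ∑ j, G.lapMatrix ℝ i j ^ 2 := by
  have h1 : ∑ i, ∑ j, G.lapMatrix ℝ i j ^ 2 =
      (G.lapMatrix ℝ * (G.lapMatrix ℝ).transpose).trace := by
    simp only [Matrix.trace, Matrix.diag, Matrix.mul_apply, Matrix.transpose_apply, sq]
  have h2 : U * Matrix.diagonal lam * U.transpose *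
      (U * Matrix.diagonal lam * U.transpose).transpose =
        U * (Matrix.diagonal lam * Matrix.diagonal lam * U.transpose) := by
    simp only [Matrix.transpose_mul, Matrix.transpose_transpose, Matrix.diagonal_transpose,
      Matrix.mul_assoc]
    rw [← Matrix.mul_assoc U.transpose U, h.transpose_mul, Matrix.one_mul]
  rw [h1, h.decomposition, h2, Matrix.trace_mul_comm, Matrix.mul_assoc, h.transpose_mul,
    Matrix.mul_one, Matrix.diagonal_mul_diagonal, Matrix.trace_diagonal]
  simp only [sq]

end IsLaplacianDecomposition

/-! ### Relabelled graphs and subgraphs -/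

section Graph

variable {n : ℕ} (G : SimpleGraph (Fin n)) [DecidableRel G.Adj]

theorem exists_isLaplacianDecomposition :
    ∃ U lam, IsLaplacianDecomposition G U lam := by
  have hA := G.isHermitian_lapMatrix ℝ
  set V : Matrix (Fin n) (Fin n) ℝ := hA.eigenvectorUnitary.1
  have hVV : V * V.transpose = 1 :=
    (Matrix.mem_orthogonalGroup_iff _ _).1 hA.eigenvectorUnitary.2
  have hspec : G.lapMatrix ℝ = V * Matrix.diagonal hA.eigenvalues * V.transpose := by
    conv_lhs => rw [hA.spectral_theorem, Unitary.conjStarAlgAut_apply]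
    rfl
  set σ := Tuple.sort hA.eigenvalues
  refine ⟨V.submatrix id σ, hA.eigenvalues ∘ σ, ?_, Tuple.monotone_sort _, ?_⟩
  · rw [Matrix.mem_orthogonalGroup_iff, Matrix.transpose_submatrix,
      Matrix.submatrix_mul_equiv, hVV]
    rfl
  · refine hspec.trans ?_
    rw [← Matrix.submatrix_diagonal_equiv, Matrix.transpose_submatrix,
      Matrix.submatrix_mul_equiv, Matrix.submatrix_mul_equiv]
    rfl

theorem lapMatrix_comap_perm (σ : Equiv.Perm (Fin n)) [DecidableRel (G.comap σ).Adj] :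
    (G.comap σ).lapMatrix ℝ = (G.lapMatrix ℝ).submatrix σ σ := by
  ext i j
  have hdeg : (G.comap σ).degree i = G.degree (σ i) :=
    ((SimpleGraph.Iso.comap σ G).degree_eq i).symm
  simp [SimpleGraph.lapMatrix, SimpleGraph.degMatrix, Matrix.diagonal_apply,
    SimpleGraph.adjMatrix_apply, hdeg]

theorem IsLaplacianDecomposition.comap_perm {U : Matrix (Fin n) (Fin n) ℝ} {lam : Fin n → ℝ}
    (h : IsLaplacianDecomposition G U lam) (σ : Equiv.Perm (Fin n))
    [DecidableRel (G.comap σ).Adj] :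
    IsLaplacianDecomposition (G.comap σ) (U.submatrix σ id) lam where
  orthogonal := (Matrix.mem_orthogonalGroup_iff _ _).2
    (submatrix_perm_mul_transpose h.mul_transpose σ)
  sorted := h.sorted
  decomposition := by
    rw [lapMatrix_comap_perm, h.decomposition]
    rfl

theorem sq_maxDegree_le_sum_sq_lapMatrix :
    (G.maxDegree : ℝ) ^ 2 ≤ ∑ i, ∑ j, G.lapMatrix ℝ i j ^ 2 := by
  rcases isEmpty_or_nonempty (Fin n) with h | h
  · simp
  obtain ⟨w, hw⟩ := G.exists_maximal_degree_vertex
  have h1 : G.lapMatrix ℝ w w ^ 2 = (G.maxDegree : ℝ) ^ 2 := by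
    simp [SimpleGraph.lapMatrix, SimpleGraph.degMatrix, hw]
  rw [← h1]
  exact (Finset.single_le_sum (f := fun j => G.lapMatrix ℝ w j ^ 2)
    (fun j _ => sq_nonneg _) (Finset.mem_univ w)).trans
    (Finset.single_le_sum (f := fun i => ∑ j, G.lapMatrix ℝ i j ^ 2)
      (fun i _ => Finset.sum_nonneg fun j _ => sq_nonneg _) (Finset.mem_univ w))

/-- Carries the bound on `M` from the subgraph used for the comparison back to the given graph. -/
theorem sum_sq_lapMatrix_mono {G' : SimpleGraph (Fin n)} [DecidableRel G'.Adj] (hle : G' ≤ G) :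
    ∑ i, ∑ j, G'.lapMatrix ℝ i j ^ 2 ≤ ∑ i, ∑ j, G.lapMatrix ℝ i j ^ 2 := by
  refine Finset.sum_le_sum fun i _ => Finset.sum_le_sum fun j _ => ?_
  rcases eq_or_ne i j with rfl | hij
  · have hd : (G'.degree i : ℝ) ≤ G.degree i := by exact_mod_cast SimpleGraph.degree_le_of_le hle
    simpa [SimpleGraph.lapMatrix, SimpleGraph.degMatrix] using
      pow_le_pow_left₀ (Nat.cast_nonneg _) hd 2
  · by_cases h' : G'.Adj i j
    · simp [SimpleGraph.lapMatrix, SimpleGraph.degMatrix, hij, SimpleGraph.adjMatrix_apply, h',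
        hle h']
    · simpa [SimpleGraph.lapMatrix, SimpleGraph.degMatrix, hij, SimpleGraph.adjMatrix_apply, h']
        using by positivity

/-- A nonempty graph on at least three nodes has a subgraph of the same maximum degree in which
some pairs of nodes are adjacent and others are not. -/
theorem exists_le_maxDegree_eq_and_adj_and_not_adj (hn : 3 ≤ n) (hG : G.maxDegree ≠ 0) :
    ∃ (G' : SimpleGraph (Fin n)) (_ : DecidableRel G'.Adj), G' ≤ G ∧ G'.maxDegree = G.maxDegree ∧
      (∃ a b, G'.Adj a b) ∧ ∃ a b, a ≠ b ∧ ¬ G'.Adj a b := by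
  classical
  have hne : G ≠ ⊥ := fun h => hG (SimpleGraph.maxDegree_eq_zero_iff.2 h)
  have hadj : ∃ a b, G.Adj a b := SimpleGraph.ne_bot_iff_exists_adj.1 hne
  by_cases h : ∃ a b, a ≠ b ∧ ¬ G.Adj a b
  · exact ⟨G, inferInstance, le_rfl, rfl, hadj, h⟩
  push Not at h
  -- Here `G` is complete. After deleting `xy`, the third node `z` still has degree `n - 1`; this is
  -- where `3 ≤ n` is needed.
  set x : Fin n := ⟨0, by omega⟩
  set y : Fin n := ⟨1, by omega⟩
  set z : Fin n := ⟨2, by omega⟩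
  have hxy : x ≠ y := by simp [x, y, Fin.ext_iff]
  have hxz : x ≠ z := by simp [x, z, Fin.ext_iff]
  have hyz : y ≠ z := by simp [y, z, Fin.ext_iff]
  have hle : G.deleteEdges {s(x, y)} ≤ G := SimpleGraph.deleteEdges_le _
  have hz : ∀ w, z ≠ w → (G.deleteEdges {s(x, y)}).Adj z w := by
    intro w hw
    rw [SimpleGraph.deleteEdges_adj]
    refine ⟨h z w hw, ?_⟩
    simp only [Set.mem_singleton_iff, Sym2.eq_iff, not_or, not_and]
    exact ⟨fun e => absurd e.symm hxz, fun e => absurd e.symm hyz⟩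
  refine ⟨G.deleteEdges {s(x, y)}, inferInstance, hle, le_antisymm ?_ ?_, ⟨z, x, hz x hxz.symm⟩,
    x, y, hxy, by simp [SimpleGraph.deleteEdges_adj]⟩
  · exact SimpleGraph.maxDegree_mono hle
  · refine SimpleGraph.maxDegree_le_of_forall_degree_le _ _ fun w => ?_
    refine (Nat.le_sub_one_of_lt (G.degree_lt_card_verts w)).trans ?_
    refine le_trans ?_ (SimpleGraph.degree_le_maxDegree _ z)
    rw [← SimpleGraph.card_neighborFinset_eq_degree, ← Finset.card_univ,
      ← Finset.card_erase_of_mem (Finset.mem_univ z)]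
    refine Finset.card_le_card fun w hw => ?_
    rw [SimpleGraph.mem_neighborFinset]
    exact hz w (Finset.ne_of_mem_erase hw).symm

end Graph

/-! ### The lower bound -/

theorem theorem5 {n H dh : ℕ} (hn : 3 ≤ n) (T : OneLayerTransformer n H dh)
    (hWin : ‖T.Win‖ ≤ 1)
    (LipMLP : ℝ≥0) (hLip : LipschitzWith LipMLP T.mlp)
    (u v : Fin n) (huv : u ≠ v) (dmax : ℕ) (hT : T.PredictsEdge u v dmax)
    (G : SimpleGraph (Fin n)) [DecidableRel G.Adj] (hG : G.maxDegree = dmax)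
    (U : Matrix (Fin n) (Fin n) ℝ) (lam : Fin n → ℝ) (hU : IsLaplacianDecomposition G U lam) :
    (dmax : ℝ) ≤
      (LipMLP : ℝ) * ‖T.WV‖ * (1 + T.logitEnergy (laplacianTokens U lam)) := by
  classical
  have hκ : 0 ≤ ⨆ h, ‖T.WQK h‖ := Real.iSup_nonneg fun h => norm_nonneg _
  have hLV : 0 ≤ (LipMLP : ℝ) * ‖T.WV‖ := by positivity
  rcases eq_or_ne dmax 0 with rfl | hd
  · unfold OneLayerTransformer.logitEnergy
    rw [Nat.cast_zero]
    positivity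
  obtain ⟨G', _, hle, hdeg, ⟨a, b, hab⟩, c, e, hce, hce'⟩ :=
    exists_le_maxDegree_eq_and_adj_and_not_adj G hn (hG ▸ hd)
  obtain ⟨U', lam', hU'⟩ := exists_isLaplacianDecomposition G'
  -- `σ` places an edge of `G'` at `(u, v)`, and `τ` a non-edge.
  obtain ⟨σ, hσu, hσv⟩ := Equiv.Perm.exists_apply_eq_and_apply_eq hab.ne huv
  obtain ⟨τ, hτu, hτv⟩ := Equiv.Perm.exists_apply_eq_and_apply_eq hce huv
  have hout : ∀ ρ : Equiv.Perm (Fin n),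
      T.edgeOutput (laplacianTokens (U'.submatrix ρ id) lam') u v =
        (G'.comap ρ).adjMatrix ℝ u v := fun ρ =>
    hT (G'.comap ρ) (((SimpleGraph.Iso.comap ρ G').maxDegree_eq).trans (hdeg.trans hG)) _ _
      (hU'.comap_perm G' ρ)
  have h1 := T.sq_sub_edgeOutput_le hWin hLip hU'.mul_transpose lam' σ τ u v
  have hσ : (G'.comap σ).Adj u v := by simpa [hσu, hσv] using hab
  have hτ : ¬ (G'.comap τ).Adj u v := by simpa [hτu, hτv] using hce'
  rw [hout, hout, SimpleGraph.adjMatrix_apply, SimpleGraph.adjMatrix_apply, if_pos hσ,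
    if_neg hτ] at h1
  have hM' : (dmax : ℝ) ^ 2 ≤ ∑ k, lam' k ^ 2 := by
    rw [hU'.sum_sq_eigenvalues, ← hG, ← hdeg]
    exact sq_maxDegree_le_sum_sq_lapMatrix G'
  have hMM : ∑ k, lam' k ^ 2 ≤ ∑ k, lam k ^ 2 := by
    rw [hU'.sum_sq_eigenvalues, hU.sum_sq_eigenvalues]
    exact sum_sq_lapMatrix_mono G hle
  have hX := one_add_le_sq_norm_laplacianTokens (by omega) hU.mul_transpose lam
  have hn3 : (3 : ℝ) ≤ n := by exact_mod_cast hn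
  unfold OneLayerTransformer.logitEnergy
  generalize ∑ k, lam' k ^ 2 = M at *
  generalize ∑ k, lam k ^ 2 = N at *
  generalize ‖laplacianTokens U lam‖ ^ 2 = E at *
  generalize (⨆ h, ‖T.WQK h‖) = κ at *
  generalize (LipMLP : ℝ) * ‖T.WV‖ = q at *
  have hM0 : 0 ≤ M := (sq_nonneg _).trans hM'
  have hE : 1 + n * M ≤ E := by nlinarith
  -- With `dmax² ≤ M`, the terms `2nM` match and `2nM² ≤ n²M²`.
  have hpoly : 2 * n * (1 + M) * (dmax : ℝ) ^ 2 ≤ (1 + n * M) ^ 2 := by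
    have e1 : 2 * n * (1 + M) * (dmax : ℝ) ^ 2 ≤ 2 * n * (1 + M) * M := by gcongr
    have e2 : 2 * (n * M ^ 2) ≤ n * (n * M ^ 2) := by gcongr; linarith
    nlinarith
  have hsq : (dmax : ℝ) ^ 2 ≤ ((1 + n * M) * (q * κ)) ^ 2 := by
    calc (dmax : ℝ) ^ 2 ≤ (2 * n * (1 + M) * (q * κ) ^ 2) * (dmax : ℝ) ^ 2 :=
          le_mul_of_one_le_left (sq_nonneg _) (by linarith)
      _ = (2 * n * (1 + M) * (dmax : ℝ) ^ 2) * (q * κ) ^ 2 := by ring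
      _ ≤ (1 + n * M) ^ 2 * (q * κ) ^ 2 := by gcongr
      _ = _ := by ring
  have hdle : (dmax : ℝ) ≤ (1 + n * M) * (q * κ) := by
    refine le_of_sq_le_sq hsq (by positivity)
  -- Gives `dmax ≤ qκE`; the remaining summand `q` is nonnegative.
  have := mul_le_mul_of_nonneg_right hE (mul_nonneg hLV hκ)
  nlinarith
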